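/- Let $q$ be a power of a prime $p$. Let $\{|x\rangle : x\in\mathbb F_q\}$ be an orthonormal basis of $\mathbb C^q$; the generalised Pauli operators on $\mathbb C^q$ are $X(a)Z(b)$, $a,b\in\mathbb F_q$, where $X(a)|x\rangle=|x+a\rangle$ and $Z(b)|x\rangle=e^{2\pi i\,\mathrm{tr}(bx)/p}|x\rangle$, with $\mathrm{tr}$ the trace from $\mathbb F_q$ to $\mathbb F_p$. A Pauli error on $(\mathbb C^q)^{\otimes n}$ is a tensor product of $n$ such operators, and its weight is the number of components that are not the identity. A subspace $Q$ of $(\mathbb C^q)^{\otimes n}$ with orthogonal projection $P$ detects an error $E$ if $PEP=cP$ for some $c\in\mathbb C$. For $K \ge 1$, an $[\![n,K,d]\!]_q$ quantum code is a subspace of $(\mathbb C^q)^{\otimes n}$ of dimension $q^K$ whose minimum distance, i.e. the least weight of a Pauli error that it does not detect, is $d$. It is a quantum MDS code if it attains the quantum Singleton bound $K\le n-2d+2$. Theorem. For every prime power $q$ and every integer $k$ with $0\le k\le q$ and $k\ne q-1$, there exists a $[\![q^2+1,\;q^2+1-2k,\;k+1]\!]_q$ quantum MDS code. -/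

import Mathlib

namespace QuantumCode

/-- The state space `(ℂ^q)^{⊗ n}` of `n` quantum systems with local basis `|x⟩`, `x ∈ F`
(`q = |F|`), written in its orthonormal product basis `|x₁⟩ ⊗ ⋯ ⊗ |xₙ⟩`, `x ∈ F ^ n`. -/
abbrev StateSpace (F : Type*) (n : ℕ) : Type _ := EuclideanSpace ℂ (Fin n → F)

/-- The operator `X(a)` on `ℂ^q`, in the basis `|x⟩`, `x ∈ F`: `X(a)|y⟩ = |y + a⟩`. -/
def shift {F : Type*} [Field F] [DecidableEq F] (a : F) : Matrix F F ℂ :=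
  Matrix.of fun x y => if x = y + a then 1 else 0

/-- The operator `Z(b)` on `ℂ^q`, in the basis `|x⟩`, `x ∈ F`:
`Z(b)|x⟩ = exp(2πi tr(bx)/p) |x⟩`, where `tr` is the trace from `F` to the prime field. -/
noncomputable def clock (p : ℕ) [Fact p.Prime] {F : Type*} [Field F] [DecidableEq F]
    [Algebra (ZMod p) F] (b : F) : Matrix F F ℂ :=
  Matrix.diagonal fun x => ZMod.stdAddChar (Algebra.trace (ZMod p) F (b * x))

/-- The generalised Pauli operators `X(a)Z(b)` on `ℂ^q`. -/
def IsPauli (p : ℕ) [Fact p.Prime] {F : Type*} [Field F] [Fintype F] [DecidableEq F]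
    [Algebra (ZMod p) F] (A : Matrix F F ℂ) : Prop :=
  ∃ a b : F, A = shift a * clock p b

/-- The tensor product `A₁ ⊗ ⋯ ⊗ Aₙ` of operators on `ℂ^q`, acting on `(ℂ^q)^{⊗ n}`: its matrix
in the product basis is the Kronecker product. -/
noncomputable def tensorOp {F : Type*} [Fintype F] [DecidableEq F] {n : ℕ}
    (A : Fin n → Matrix F F ℂ) : StateSpace F n →ₗ[ℂ] StateSpace F n :=
  Matrix.toEuclideanLin (Matrix.of fun x y : Fin n → F => ∏ i, A i (x i) (y i))

/-- The weight of an error `A₁ ⊗ ⋯ ⊗ Aₙ`: the number of components that are not the identity. -/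
noncomputable def weight {F : Type*} [DecidableEq F] {n : ℕ} (A : Fin n → Matrix F F ℂ) : ℕ :=
  {i | A i ≠ 1}.ncard

/-- The code `Q` detects the error `E`: with `P` the orthogonal projection onto `Q`, one has
`P E P = c P` for a scalar `c`. (This is `⟨u, E v⟩ = c ⟨u, v⟩` for all `u, v ∈ Q`.) -/
def Detects {F : Type*} [Fintype F] {n : ℕ} (Q : Submodule ℂ (StateSpace F n))
    (E : StateSpace F n →ₗ[ℂ] StateSpace F n) : Prop :=
  ∃ c : ℂ, ∀ u ∈ Q, ∀ v ∈ Q, inner ℂ u (E v) = c * inner ℂ u v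

/-- `Q` has minimum distance `d`: it detects all Pauli errors of weight at most `d - 1`,
and `d` is the largest number with this property; that is, `d` is the least weight of a Pauli error
that `Q` does not detect. (For codes of dimension at least two; a one-dimensional
code detects every error.) -/
def HasMinDist (p : ℕ) [Fact p.Prime] {F : Type*} [Field F] [Fintype F] [DecidableEq F]
    [Algebra (ZMod p) F] {n : ℕ} (Q : Submodule ℂ (StateSpace F n)) (d : ℕ) : Prop :=
  IsLeast {w : ℕ | ∃ A : Fin n → Matrix F F ℂ,
    (∀ i, IsPauli p (A i)) ∧ weight A = w ∧ ¬ Detects Q (tensorOp A)} d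

/-- `Q` is an `[[n, k, d]]_q` quantum code, `q = |F|`. -/
structure IsCode (p : ℕ) [Fact p.Prime] {F : Type*} [Field F] [Fintype F] [DecidableEq F]
    [Algebra (ZMod p) F] {n : ℕ} (Q : Submodule ℂ (StateSpace F n)) (k d : ℕ) : Prop where
  finrank_eq : Module.finrank ℂ Q = Fintype.card F ^ k
  hasMinDist : HasMinDist p Q d

/-- `Q` is an `[[n, k, d]]_q` quantum MDS code: it attains the quantum Singleton bound
`k ≤ n - 2d + 2`. -/
structure IsMDSCode (p : ℕ) [Fact p.Prime] {F : Type*} [Field F] [Fintype F] [DecidableEq F]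
    [Algebra (ZMod p) F] {n : ℕ} (Q : Submodule ℂ (StateSpace F n)) (k d : ℕ) : Prop
    extends IsCode p Q k d where
  singleton_eq : (k : ℤ) = (n : ℤ) - 2 * (d : ℤ) + 2

end QuantumCode

open Module Polynomial

/-! Let `K` be the quadratic extension of `F`, with `q²` elements. Polynomials over `K` of degree
less than `q`, evaluated at all points of `K` and at `∞` (coefficient of degree `q - 1`), are
Hermitian self-orthogonal: `∑ x, x ^ (i + j * q)` vanishes for `i, j < q` unless `i = j = q - 1`,
and that one term `-1` is cancelled by the coordinate at `∞`. Fix a monic `u` of degree `q - k`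
without roots in `K`; it exists because `q - k ≠ 1`. The words of the polynomials `u * f`, `deg f <
k`, form a self-orthogonal code that is an extended Reed-Solomon code up to nonzero column factors,
hence MDS of dimension `k`. Its Hermitian dual therefore has minimum distance `k + 1`, attained by a
vector outside the code. Writing `K = F + F ω` turns the code into an isotropic subspace of `F ^ n ×
F ^ n`, and a joint eigenspace of the corresponding Pauli operators is the quantum code
(`exists_stabilizer_code`, `exists_isCode_of_hermitian`). -/

/-- A commuting family of endomorphisms of a nonzero finite-dimensional vector space over an
algebraically closed field has a common eigenvector. -/
theorem Module.End.exists_common_eigenvector {K V ι : Type*} [Field K] [IsAlgClosed K]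
    [AddCommGroup V] [Module K V] [FiniteDimensional K V] [Nontrivial V] (f : ι → Module.End K V)
    (hf : ∀ i j, Commute (f i) (f j)) : ∃ v : V, v ≠ 0 ∧ ∀ i, ∃ c : K, f i v = c • v := by
  -- A minimal nonzero invariant subspace lies in a single eigenspace of each `f i`: its
  -- intersection with an eigenspace is again invariant, by commutation.
  obtain ⟨W, ⟨hW0, hW⟩, hmin⟩ := (wellFounded_lt (α := Submodule K V)).has_min
    {W | W ≠ ⊥ ∧ ∀ i, ∀ w ∈ W, f i w ∈ W} ⟨⊤, top_ne_bot, by simp⟩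
  obtain ⟨v, hv, hv0⟩ := W.exists_mem_ne_zero_of_ne_bot hW0
  refine ⟨v, hv0, fun i => ?_⟩
  have : Nontrivial W := Submodule.nontrivial_iff_ne_bot.2 hW0
  obtain ⟨c, hc⟩ := Module.End.exists_eigenvalue ((f i).restrict (hW i))
  obtain ⟨w, hw⟩ := hc.exists_hasEigenvector
  refine ⟨c, ?_⟩
  have hle : W ⊓ End.eigenspace (f i) c = W := by
    by_contra hne
    refine hmin (W ⊓ End.eigenspace (f i) c) ⟨?_, ?_⟩ (lt_of_le_of_ne inf_le_left hne)
    · rw [Submodule.ne_bot_iff]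
      refine ⟨w, ⟨w.2, ?_⟩, by simpa using hw.2⟩
      simpa [End.mem_eigenspace_iff, Subtype.ext_iff] using hw.apply_eq_smul
    · rintro j x ⟨hx, hx'⟩
      refine ⟨hW j x hx, ?_⟩
      simp only [SetLike.mem_coe, End.mem_eigenspace_iff] at hx' ⊢
      rw [← Module.End.mul_apply, (hf i j).eq, Module.End.mul_apply, hx', map_smul]
  rw [← hle] at hv
  exact End.mem_eigenspace_iff.1 hv.2

namespace QuantumCode

/-! ### Pauli operators and the symplectic form -/

section Pauli

variable {F : Type*} [Field F] {n : ℕ}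

/-- The symplectic form on `F ^ n × F ^ n`. -/
def symp (s t : (Fin n → F) × (Fin n → F)) : F := s.2 ⬝ᵥ t.1 - t.2 ⬝ᵥ s.1

theorem symp_smul_left (c : F) (s t : (Fin n → F) × (Fin n → F)) :
    symp (c • s) t = c * symp s t := by
  simp [symp, mul_sub]

variable [Fintype F] [DecidableEq F]

/-- The Pauli operator `X(a₁)Z(b₁) ⊗ ⋯ ⊗ X(aₙ)Z(bₙ)`, for a general additive character. -/
noncomputable def pauliOp (χ : AddChar F ℂ) (s : (Fin n → F) × (Fin n → F)) :
    StateSpace F n →ₗ[ℂ] StateSpace F n :=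
  Matrix.toEuclideanLin (Matrix.of fun x y => if x = y + s.1 then χ (s.2 ⬝ᵥ y) else 0)

variable (χ : AddChar F ℂ)

theorem pauliOp_apply (s : (Fin n → F) × (Fin n → F)) (v : StateSpace F n) (x : Fin n → F) :
    pauliOp χ s v x = χ (s.2 ⬝ᵥ (x - s.1)) * v (x - s.1) := by
  simp only [pauliOp, Matrix.toLpLin_apply, Matrix.mulVec, dotProduct, Matrix.of_apply]
  rw [Finset.sum_eq_single (x - s.1)]
  · simp
  · intro y _ hy
    rw [if_neg (fun h => hy (by simp [h])), zero_mul]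
  · simp

theorem pauliOp_mul (s t : (Fin n → F) × (Fin n → F)) :
    pauliOp χ s * pauliOp χ t = χ (s.2 ⬝ᵥ t.1) • pauliOp χ (s + t) := by
  ext v x
  simp only [Module.End.mul_apply, LinearMap.smul_apply, PiLp.smul_apply, smul_eq_mul,
    pauliOp_apply, Prod.fst_add, Prod.snd_add, sub_sub, ← mul_assoc, ← AddChar.map_add_eq_mul]
  congr 2
  simp only [add_dotProduct, dotProduct_sub, dotProduct_add]
  ring

theorem pauliOp_zero : pauliOp χ (0 : (Fin n → F) × (Fin n → F)) = 1 := by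
  ext v x
  simp [pauliOp_apply]

theorem pauliOp_commutation (s t : (Fin n → F) × (Fin n → F)) :
    pauliOp χ s * pauliOp χ t = χ (symp s t) • (pauliOp χ t * pauliOp χ s) := by
  rw [pauliOp_mul, pauliOp_mul, smul_smul, ← AddChar.map_add_eq_mul, add_comm t s, symp,
    sub_add_cancel]

theorem pauliOp_ne_zero (s : (Fin n → F) × (Fin n → F)) {v : StateSpace F n} (hv : v ≠ 0) :
    pauliOp χ s v ≠ 0 := by
  intro h
  have h1 := congrArg (pauliOp χ (-s)) h
  rw [map_zero, ← Module.End.mul_apply, pauliOp_mul, neg_add_cancel, pauliOp_zero] at h1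
  exact hv ((smul_eq_zero.1 h1).resolve_left (χ.val_isUnit _).ne_zero)

theorem inner_pauliOp (s : (Fin n → F) × (Fin n → F)) (u v : StateSpace F n) :
    inner ℂ (pauliOp χ s u) (pauliOp χ s v) = inner ℂ u v := by
  simp only [PiLp.inner_apply, pauliOp_apply]
  rw [← Equiv.sum_comp (Equiv.subRight s.1) (fun x => inner ℂ (u x) (v x))]
  refine Finset.sum_congr rfl fun x _ => ?_
  have h : χ (s.2 ⬝ᵥ (x - s.1)) * (starRingEnd ℂ) (χ (s.2 ⬝ᵥ (x - s.1))) = 1 := by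
    rw [← AddChar.map_neg_eq_conj, ← AddChar.map_add_eq_mul, add_neg_cancel, AddChar.map_zero_eq_one]
  simp only [RCLike.inner_apply, map_mul, Equiv.subRight_apply]
  linear_combination (v (x - s.1) * (starRingEnd ℂ) (u (x - s.1))) * h

/-- If `s.1 ≠ 0`, the diagonal of the matrix is zero; otherwise the trace is the sum of a nontrivial
character of `F ^ n`. -/
theorem trace_pauliOp {χ : AddChar F ℂ} (hχ : χ.IsPrimitive) {s : (Fin n → F) × (Fin n → F)}
    (hs : s ≠ 0) : LinearMap.trace ℂ _ (pauliOp χ s) = 0 := by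
  have key : LinearMap.trace ℂ _ (pauliOp χ s)
      = ∑ x : Fin n → F, if x = x + s.1 then χ (s.2 ⬝ᵥ x) else 0 := by
    rw [pauliOp, Matrix.toEuclideanLin, Matrix.toLpLin_eq_toLin,
      LinearMap.trace_eq_matrix_trace ℂ (PiLp.basisFun 2 ℂ (Fin n → F)),
      LinearMap.toMatrix_toLin]
    rfl
  rw [key]
  by_cases h1 : s.1 = 0
  · obtain ⟨i, hi⟩ : ∃ i, s.2 i ≠ 0 := by
      by_contra! h2
      exact hs (Prod.ext h1 (funext h2))
    obtain ⟨r, hr⟩ := AddChar.ne_one_iff.1 (hχ hi)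
    let ψ : AddChar (Fin n → F) ℂ :=
      { toFun := fun x => χ (s.2 ⬝ᵥ x)
        map_zero_eq_one' := by simp
        map_add_eq_mul' := fun x y => by rw [dotProduct_add, AddChar.map_add_eq_mul] }
    have hψ : ψ ≠ 1 := by
      refine AddChar.ne_one_iff.2 ⟨Pi.single i r, ?_⟩
      simpa [ψ, AddChar.mulShift_apply] using hr
    simpa [h1] using! AddChar.sum_eq_zero_of_ne_one hψ
  · simp [h1]

end Pauli

/-! ### Stabilizer codes: dimension and detected errors -/

section Stabilizer

variable {F : Type*} [Field F] [Fintype F] [DecidableEq F] {n : ℕ} {χ : AddChar F ℂ}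

/-- The simultaneous eigenspace of the Pauli operators in `S` with eigenvalues `μ`. -/
noncomputable def stabilizerCode (χ : AddChar F ℂ) (S : Submodule F ((Fin n → F) × (Fin n → F)))
    (μ : S → ℂ) : Submodule ℂ (StateSpace F n) :=
  ⨅ s : S, End.eigenspace (pauliOp χ (s : (Fin n → F) × (Fin n → F))) (μ s)

theorem mem_stabilizerCode {S : Submodule F ((Fin n → F) × (Fin n → F))} {μ : S → ℂ}
    {v : StateSpace F n} :
    v ∈ stabilizerCode χ S μ ↔ ∀ s : S, pauliOp χ (s : (Fin n → F) × (Fin n → F)) v = μ s • v := by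
  simp [stabilizerCode]

/-- The Pauli operators in an isotropic subspace have a system of simultaneous eigenvalues. -/
theorem exists_eigenvalues {S : Submodule F ((Fin n → F) × (Fin n → F))}
    (hS : ∀ s ∈ S, ∀ t ∈ S, symp s t = 0) :
    ∃ μ : S → ℂ, (∀ s, μ s ≠ 0) ∧
      ∀ s t : S, μ s * μ t = χ ((s : (Fin n → F) × (Fin n → F)).2 ⬝ᵥ
        (t : (Fin n → F) × (Fin n → F)).1) * μ (s + t) := by
  -- The eigenvalues on one common eigenvector inherit the multiplication rule `pauliOp_mul`.
  obtain ⟨v, hv, h⟩ := Module.End.exists_common_eigenvector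
    (fun s : S => pauliOp χ (s : (Fin n → F) × (Fin n → F))) fun s t => by
      rw [commute_iff_eq, pauliOp_commutation, hS s s.2 t t.2, AddChar.map_zero_eq_one, one_smul]
  choose μ hμ using h
  refine ⟨μ, fun s hs => ?_, fun s t => ?_⟩
  · exact pauliOp_ne_zero χ _ hv (by rw [hμ, hs, zero_smul])
  · have h1 := congrArg (fun f => f v) (pauliOp_mul χ (s : (Fin n → F) × (Fin n → F)) t)
    have h2 := hμ (s + t)
    simp only [Submodule.coe_add] at h2
    simp only [Module.End.mul_apply, LinearMap.smul_apply, hμ, map_smul, h2, smul_smul] at h1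
    rw [mul_comm]
    exact smul_left_injective ℂ hv h1

variable {S : Submodule F ((Fin n → F) × (Fin n → F))} {μ : S → ℂ}

/-- The projection onto the stabilizer code, as an average over the stabilizer. -/
noncomputable def stabilizerProj (χ : AddChar F ℂ) (S : Submodule F ((Fin n → F) × (Fin n → F)))
    (μ : S → ℂ) : StateSpace F n →ₗ[ℂ] StateSpace F n :=
  (Nat.card S : ℂ)⁻¹ • ∑ᶠ s : S, (μ s)⁻¹ • pauliOp χ (s : (Fin n → F) × (Fin n → F))

/-- Multiplying by one stabilizer element permutes the terms of the average, by the multiplication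
rule for `μ`; on the code each term is the identity. -/
theorem isProj_stabilizerProj (hμ0 : ∀ s, μ s ≠ 0)
    (hμ : ∀ s t : S, μ s * μ t = χ ((s : (Fin n → F) × (Fin n → F)).2 ⬝ᵥ
        (t : (Fin n → F) × (Fin n → F)).1) * μ (s + t)) :
    LinearMap.IsProj (stabilizerCode χ S μ) (stabilizerProj χ S μ) := by
  classical
  have := Fintype.ofFinite S
  refine ⟨fun v => mem_stabilizerCode.2 fun t => ?_, fun v hv => ?_⟩
  · rw [stabilizerProj, finsum_eq_sum_of_fintype, ← Module.End.mul_apply, ← LinearMap.smul_apply]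
    congr 1
    rw [mul_smul_comm, smul_comm (μ t), Finset.mul_sum]
    congr 1
    rw [Finset.smul_sum]
    rw [← Equiv.sum_comp (Equiv.addLeft t)
      (fun s : S => μ t • (μ s)⁻¹ • pauliOp χ (s : (Fin n → F) × (Fin n → F)))]
    refine Finset.sum_congr rfl fun s _ => ?_
    rw [mul_smul_comm, pauliOp_mul, smul_smul, smul_smul, Equiv.coe_addLeft, Submodule.coe_add]
    congr 1
    have h1 := hμ0 s
    have h2 := hμ0 (t + s)
    field_simp
    rw [mul_comm (μ s), hμ]
  · rw [stabilizerProj, finsum_eq_sum_of_fintype, LinearMap.smul_apply, LinearMap.sum_apply]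
    rw [Finset.sum_congr rfl (g := fun _ => v) fun s _ => by
      rw [LinearMap.smul_apply, mem_stabilizerCode.1 hv, smul_smul, inv_mul_cancel₀ (hμ0 s),
        one_smul]]
    rw [Finset.sum_const, Finset.card_univ, ← Nat.card_eq_fintype_card, ← Nat.cast_smul_eq_nsmul ℂ,
      smul_smul, inv_mul_cancel₀ (Nat.cast_ne_zero.2 Nat.card_pos.ne'), one_smul]

/-- Every term is a multiple of a Pauli operator with label `e + s ≠ 0`, which is traceless. -/
theorem trace_mul_stabilizerProj (hχ : χ.IsPrimitive) {e : (Fin n → F) × (Fin n → F)}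
    (he : e ∉ S) : LinearMap.trace ℂ _ (pauliOp χ e * stabilizerProj χ S μ) = 0 := by
  have := Fintype.ofFinite S
  rw [stabilizerProj, finsum_eq_sum_of_fintype, mul_smul_comm, Finset.mul_sum, map_smul, map_sum,
    Finset.sum_eq_zero, smul_zero]
  intro s _
  rw [mul_smul_comm, pauliOp_mul, map_smul, map_smul, trace_pauliOp hχ, smul_zero, smul_zero]
  intro h
  exact he (by rw [eq_neg_of_add_eq_zero_left h]; exact S.neg_mem s.2)

/-- Only `s = 0` contributes. As the trace of a projection is its rank, this gives the dimension of
the code. -/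
theorem trace_stabilizerProj (hχ : χ.IsPrimitive) (hμ : μ 0 = 1) :
    LinearMap.trace ℂ _ (stabilizerProj χ S μ) =
      (Nat.card S : ℂ)⁻¹ * (Fintype.card F : ℂ) ^ n := by
  classical
  have := Fintype.ofFinite S
  rw [stabilizerProj, finsum_eq_sum_of_fintype, map_smul, map_sum, Finset.sum_eq_single 0]
  · rw [hμ, inv_one, one_smul, Submodule.coe_zero, pauliOp_zero, LinearMap.trace_one, smul_eq_mul]
    simp
  · intro s _ hs
    rw [map_smul, trace_pauliOp hχ (by simpa using hs), smul_zero]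
  · simp

/-- An isotropic subspace `S` of `F ^ n × F ^ n` gives a quantum code that detects exactly the Pauli
errors which lie in `S` or do not commute with all of `S`. -/
theorem exists_stabilizer_code (hχ : χ.IsPrimitive) (S : Submodule F ((Fin n → F) × (Fin n → F)))
    (hS : ∀ s ∈ S, ∀ t ∈ S, symp s t = 0) :
    ∃ Q : Submodule ℂ (StateSpace F n),
      Module.finrank ℂ Q * Nat.card S = Fintype.card F ^ n ∧
      ∀ e, Detects Q (pauliOp χ e) ↔ e ∈ S ∨ ∃ s ∈ S, symp s e ≠ 0 := by
  obtain ⟨μ, hμ0, hμ⟩ := exists_eigenvalues (χ := χ) hS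
  have hμ1 : μ 0 = 1 := by
    have := hμ 0 0
    simp only [Submodule.coe_zero, Prod.snd_zero, Prod.fst_zero, dotProduct_zero,
      AddChar.map_zero_eq_one, one_mul, add_zero] at this
    exact mul_left_cancel₀ (hμ0 0) (by rw [this, mul_one])
  have hproj := isProj_stabilizerProj hμ0 hμ
  have hcard : (Nat.card S : ℂ) ≠ 0 := Nat.cast_ne_zero.2 Nat.card_pos.ne'
  have hdim : Module.finrank ℂ (stabilizerCode χ S μ) * Nat.card S = Fintype.card F ^ n := by
    have h := hproj.trace
    rw [trace_stabilizerProj hχ hμ1, inv_mul_eq_iff_eq_mul₀ hcard] at h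
    rw [mul_comm]
    exact_mod_cast h.symm
  have hpos : Module.finrank ℂ (stabilizerCode χ S μ) ≠ 0 := by
    intro h0
    rw [h0, zero_mul] at hdim
    exact pow_ne_zero n Fintype.card_ne_zero hdim.symm
  refine ⟨stabilizerCode χ S μ, hdim, fun e => ⟨fun ⟨c, hc⟩ => ?_, ?_⟩⟩
  -- An error commuting with `S` preserves the code, so detection makes it a scalar `c` there.
  -- Outside `S` the trace forces `c = 0`, against invertibility.
  · by_contra! hcon
    obtain ⟨heS, hcomm⟩ := hcon
    have hmap : ∀ v ∈ stabilizerCode χ S μ, pauliOp χ e v ∈ stabilizerCode χ S μ := by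
      intro v hv
      refine mem_stabilizerCode.2 fun s => ?_
      rw [← Module.End.mul_apply, pauliOp_commutation, hcomm s s.2, AddChar.map_zero_eq_one,
        one_smul, Module.End.mul_apply, mem_stabilizerCode.1 hv, map_smul]
    have hscal : ∀ v ∈ stabilizerCode χ S μ, pauliOp χ e v = c • v := by
      intro v hv
      have hmem := Submodule.sub_mem _ (hmap v hv) (Submodule.smul_mem _ c hv)
      have h := hc _ hmem v hv
      rw [← inner_smul_right, ← sub_eq_zero, ← inner_sub_right, inner_self_eq_zero] at h
      exact sub_eq_zero.1 h
    have htr := trace_mul_stabilizerProj (μ := μ) hχ heS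
    have hmul : pauliOp χ e * stabilizerProj χ S μ = c • stabilizerProj χ S μ :=
      LinearMap.ext fun v => hscal _ (hproj.map_mem v)
    rw [hmul, map_smul, hproj.trace, smul_eq_mul, mul_eq_zero] at htr
    have hc0 : c = 0 := htr.resolve_right (Nat.cast_ne_zero.2 hpos)
    have hbot : stabilizerCode χ S μ ≠ ⊥ := fun h => hpos (by rw [h, finrank_bot])
    obtain ⟨v, hv, hv0⟩ := Submodule.exists_mem_ne_zero_of_ne_bot hbot
    exact pauliOp_ne_zero χ e hv0 (by rw [hscal v hv, hc0, zero_smul])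
  · rintro (he | ⟨s, hs, hse⟩)
    · refine ⟨μ ⟨e, he⟩, fun u _ v hv => ?_⟩
      rw [mem_stabilizerCode.1 hv ⟨e, he⟩, inner_smul_right]
    -- `symp s e ≠ 0` does not give `χ (symp s e) ≠ 1`; by `F`-linearity of `S`, some multiple `r •
    -- s` does.
    · obtain ⟨r, hr⟩ := AddChar.ne_one_iff.1 (hχ hse)
      rw [AddChar.mulShift_apply, mul_comm, ← symp_smul_left] at hr
      have hrs : r • s ∈ S := S.smul_mem r hs
      refine ⟨0, fun u hu v hv => ?_⟩
      rw [zero_mul]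
      obtain rfl | hu0 := eq_or_ne u 0
      · exact inner_zero_left _
      have hu1 := mem_stabilizerCode.1 hu ⟨_, hrs⟩
      have hv1 := mem_stabilizerCode.1 hv ⟨_, hrs⟩
      -- The error moves `v` to a different eigenspace of the unitary `pauliOp χ (r • s)`, hence
      -- orthogonal to `u`.
      have hev : pauliOp χ (r • s) (pauliOp χ e v)
          = (χ (symp (r • s) e) * μ ⟨_, hrs⟩) • pauliOp χ e v := by
        rw [← Module.End.mul_apply, pauliOp_commutation, LinearMap.smul_apply,
          Module.End.mul_apply, hv1, map_smul, smul_smul]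
      have h1 := inner_pauliOp χ (r • s) u u
      have h2 := inner_pauliOp χ (r • s) u (pauliOp χ e v)
      rw [hev, hu1, inner_smul_left, inner_smul_right] at h2
      rw [hu1, inner_smul_left, inner_smul_right, ← mul_assoc] at h1
      have h3 := mul_right_cancel₀ (inner_self_ne_zero.2 hu0) (h1.trans (one_mul _).symm)
      have h4 : (χ (symp (r • s) e) - 1) * inner ℂ u (pauliOp χ e v) = 0 := by
        linear_combination h2 - χ (symp (r • s) e) * inner ℂ u (pauliOp χ e v) * h3
      exact (mul_eq_zero.1 h4).resolve_left (sub_ne_zero.2 hr)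

end Stabilizer

/-! ### Pauli errors for the trace character -/

section Errors

variable (p : ℕ) [Fact p.Prime] (F : Type*) [Field F] [Fintype F]
  [Algebra (ZMod p) F]

/-- The additive character `x ↦ exp(2πi tr(x)/p)` of a finite field of characteristic `p`. -/
noncomputable def traceChar : AddChar F ℂ :=
  (ZMod.stdAddChar (N := p)).compAddMonoidHom (Algebra.trace (ZMod p) F).toAddMonoidHom

theorem traceChar_isPrimitive : (traceChar p F).IsPrimitive := by
  refine AddChar.IsPrimitive.of_ne_one (AddChar.ne_one_iff.2 ?_)
  obtain ⟨x, hx⟩ := Algebra.trace_surjective (ZMod p) F 1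
  refine ⟨x, fun h => one_ne_zero (α := ZMod p) (ZMod.injective_stdAddChar ?_)⟩
  rw [AddChar.map_zero_eq_one, ← hx]
  exact h

variable {F} [DecidableEq F]

theorem shift_mul_clock_apply (a b x y : F) :
    (shift a * clock p b) x y = if x = y + a then traceChar p F (b * y) else 0 := by
  simp [clock, shift, Matrix.mul_diagonal, traceChar]

theorem shift_mul_clock_eq_one_iff (a b : F) :
    shift a * clock p b = 1 ↔ a = 0 ∧ b = 0 := by
  constructor
  · intro h
    have h1 (x y : F) := congrFun (congrFun h x) y
    simp only [shift_mul_clock_apply] at h1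
    have ha : a = 0 := (by simpa using h1 0 0 : (0 : F) = a).symm
    refine ⟨ha, ?_⟩
    by_contra hb
    obtain ⟨r, hr⟩ := AddChar.ne_one_iff.1 (traceChar_isPrimitive p F hb)
    exact hr (by simpa [ha] using h1 r r)
  · rintro ⟨rfl, rfl⟩
    ext x y
    simp [shift_mul_clock_apply, Matrix.one_apply]

theorem tensorOp_shift_mul_clock {n : ℕ} (e : (Fin n → F) × (Fin n → F)) :
    tensorOp (fun i => shift (e.1 i) * clock p (e.2 i)) = pauliOp (traceChar p F) e := by
  rw [tensorOp, pauliOp]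
  congr 2
  ext x y
  simp only [shift_mul_clock_apply]
  by_cases h : x = y + e.1
  · rw [if_pos h, dotProduct]
    refine Eq.trans ?_ (map_prod (traceChar p F).toMonoidHom
      (fun i => Multiplicative.ofAdd (e.2 i * y i)) Finset.univ).symm
    exact Finset.prod_congr rfl fun i _ => if_pos (congrFun h i)
  · rw [if_neg h]
    obtain ⟨i, hi⟩ := Function.ne_iff.1 h
    exact Finset.prod_eq_zero (Finset.mem_univ i) (if_neg hi)

/-- An isotropic subspace of `F ^ n × F ^ n` gives a quantum code whose minimum distance is the
least weight of a vector in its symplectic complement which does not belong to it. -/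
theorem exists_isCode_of_isotropic {n k d : ℕ} (S : Submodule F ((Fin n → F) × (Fin n → F)))
    (hS : ∀ s ∈ S, ∀ t ∈ S, symp s t = 0) (hcard : Nat.card S = Fintype.card F ^ k) (hk : k ≤ n)
    (hd : IsLeast {w : ℕ | ∃ e : (Fin n → F) × (Fin n → F), (∀ s ∈ S, symp s e = 0) ∧ e ∉ S ∧
      {i | ¬ (e.1 i = 0 ∧ e.2 i = 0)}.ncard = w} d) :
    ∃ Q : Submodule ℂ (StateSpace F n), IsCode p Q (n - k) d := by
  obtain ⟨Q, hQ, hdet⟩ := exists_stabilizer_code (traceChar_isPrimitive p F) S hS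
  refine ⟨Q, ?_, ?_⟩
  · refine Nat.eq_of_mul_eq_mul_right (pow_pos (Fintype.card_pos (α := F)) k) ?_
    rw [← hcard, hQ, hcard, ← pow_add, Nat.sub_add_cancel hk]
  · unfold HasMinDist
    convert hd using 1
    ext w
    have hw (e : (Fin n → F) × (Fin n → F)) :
        weight (fun i => shift (e.1 i) * clock p (e.2 i)) =
          {i | ¬ (e.1 i = 0 ∧ e.2 i = 0)}.ncard := by
      simp only [weight, ne_eq, shift_mul_clock_eq_one_iff]
    have hn (e : (Fin n → F) × (Fin n → F)) :
        ¬ Detects Q (tensorOp fun i => shift (e.1 i) * clock p (e.2 i)) ↔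
          (∀ s ∈ S, symp s e = 0) ∧ e ∉ S := by
      rw [tensorOp_shift_mul_clock, hdet]
      push Not
      exact and_comm
    constructor
    · rintro ⟨A, hA, rfl, hnd⟩
      choose a b hab using hA
      obtain rfl : A = fun i => shift (a i) * clock p (b i) := funext hab
      obtain ⟨h1, h2⟩ := (hn (a, b)).1 hnd
      exact ⟨(a, b), h1, h2, (hw (a, b)).symm⟩
    · rintro ⟨e, h1, h2, rfl⟩
      exact ⟨_, fun i => ⟨e.1 i, e.2 i, rfl⟩, hw e, (hn e).2 ⟨h1, h2⟩⟩

end Errors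

/-! ### From Hermitian to symplectic self-orthogonality -/

section Hermitian

variable {F K : Type*} [Field F] [Field K] [Algebra F K] {n : ℕ}

/-- The map `(a, b) ↦ a + b ω` from `F ^ n × F ^ n` to `K ^ n`, for an extension `K` of `F`. -/
def toExtension (n : ℕ) (ω : K) : ((Fin n → F) × (Fin n → F)) →ₗ[F] (Fin n → K) where
  toFun s i := algebraMap F K (s.1 i) + algebraMap F K (s.2 i) * ω
  map_add' s t := by
    ext i
    simp only [Prod.fst_add, Prod.snd_add, Pi.add_apply, map_add]
    ring
  map_smul' c s := by
    ext i
    simp only [Prod.smul_fst, Prod.smul_snd, Pi.smul_apply, smul_eq_mul, map_mul, RingHom.id_apply]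
    rw [Algebra.smul_def]
    ring

theorem toExtension_apply (ω : K) (s : (Fin n → F) × (Fin n → F)) (i : Fin n) :
    toExtension n ω s i = algebraMap F K (s.1 i) + algebraMap F K (s.2 i) * ω := rfl

theorem algebraMap_add_mul_eq_zero_iff {σ : K →ₐ[F] K} {ω : K} (hω : σ ω ≠ ω) (a b : F) :
    algebraMap F K a + algebraMap F K b * ω = 0 ↔ a = 0 ∧ b = 0 := by
  constructor
  · intro h
    have h1 := congrArg σ h
    rw [map_add, map_mul, AlgHom.commutes, AlgHom.commutes, map_zero] at h1
    have h2 : algebraMap F K b * (σ ω - ω) = 0 := by linear_combination h1 - h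
    have hb : b = 0 := by simpa [sub_ne_zero.2 hω] using h2
    refine ⟨?_, hb⟩
    simpa [hb] using h
  · rintro ⟨rfl, rfl⟩
    simp

/-- Since `σ` fixes `F` and moves `ω`, the elements `1, ω` are independent over `F`; both sides have
dimension `2n`. -/
theorem toExtension_bijective [Finite F] (hK : Module.finrank F K = 2) {σ : K →ₐ[F] K} {ω : K}
    (hω : σ ω ≠ ω) : Function.Bijective (toExtension (F := F) n ω) := by
  have : FiniteDimensional F K := Module.finite_of_finrank_eq_succ hK
  have hinj : Function.Injective (toExtension (F := F) n ω) := by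
    rw [← LinearMap.ker_eq_bot, LinearMap.ker_eq_bot']
    intro s hs
    have h (i) := (algebraMap_add_mul_eq_zero_iff hω (s.1 i) (s.2 i)).1 (congrFun hs i)
    exact Prod.ext (funext fun i => (h i).1) (funext fun i => (h i).2)
  refine ⟨hinj, (LinearMap.injective_iff_surjective_of_finrank_eq_finrank ?_).1 hinj⟩
  rw [Module.finrank_prod, Module.finrank_fin_fun, Module.finrank_pi_fintype]
  simp [hK, mul_two]

/-- The symplectic form is, up to a factor, the skew part of the Hermitian form. -/
theorem hermitian_sub_conj {σ : K →ₐ[F] K} {ω : K} (hσ : ∀ x, σ (σ x) = x)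
    (s t : (Fin n → F) × (Fin n → F)) :
    (∑ i, toExtension n ω s i * σ (toExtension n ω t i)) -
        σ (∑ i, toExtension n ω s i * σ (toExtension n ω t i)) =
      algebraMap F K (symp s t) * (ω - σ ω) := by
  simp only [symp, dotProduct, map_sum, map_mul, hσ, map_sub, toExtension_apply, map_add,
    AlgHom.commutes]
  rw [← Finset.sum_sub_distrib, ← Finset.sum_sub_distrib, Finset.sum_mul]
  refine Finset.sum_congr rfl fun i _ => ?_
  ring

theorem symp_eq_zero_iff {σ : K →ₐ[F] K} {ω : K} (hσ : ∀ x, σ (σ x) = x) (hω : σ ω ≠ ω)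
    (s t : (Fin n → F) × (Fin n → F)) :
    symp s t = 0 ↔ σ (∑ i, toExtension n ω s i * σ (toExtension n ω t i)) =
      ∑ i, toExtension n ω s i * σ (toExtension n ω t i) := by
  rw [eq_comm (a := σ _), ← sub_eq_zero (b := σ _), hermitian_sub_conj hσ, mul_eq_zero,
    or_iff_left (sub_ne_zero.2 hω.symm), map_eq_zero]

variable [Fintype F] [DecidableEq F] [Fintype K] [DecidableEq K]

/-- A Hermitian self-orthogonal code over the quadratic extension of `F` gives a quantum code, whose
minimum distance is the least weight of a vector in the dual but not in the code. -/
theorem exists_isCode_of_hermitian (p : ℕ) [Fact p.Prime] [Algebra (ZMod p) F]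
    (hK : Module.finrank F K = 2) {k d : ℕ} (C : Submodule K (Fin n → K))
    (hC : ∀ c ∈ C, ∀ c' ∈ C, ∑ i, c i * c' i ^ Fintype.card F = 0)
    (hrank : Module.finrank K C = k) (hk : 2 * k ≤ n)
    (hd : IsLeast {w : ℕ | ∃ v : Fin n → K, (∀ c ∈ C, ∑ i, c i * v i ^ Fintype.card F = 0) ∧
      v ∉ C ∧ hammingNorm v = w} d) :
    ∃ Q : Submodule ℂ (StateSpace F n), IsCode p Q (n - 2 * k) d := by
  have : FiniteDimensional F K := Module.finite_of_finrank_eq_succ hK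
  set σ := FiniteField.frobeniusAlgHom F K with hσdef
  have hσq (x : K) : σ x = x ^ Fintype.card F := rfl
  have hcardK : Fintype.card K = Fintype.card F ^ 2 := by
    rw [← hK]; exact Module.card_eq_pow_finrank
  have hσ (x : K) : σ (σ x) = x := by
    rw [hσq, hσq, ← pow_mul, ← sq, ← hcardK, FiniteField.pow_card]
  obtain ⟨ω, hω⟩ : ∃ ω, σ ω ≠ ω := by
    by_contra! h
    have h1 : σ = 1 := AlgHom.ext h
    have h2 := FiniteField.orderOf_frobeniusAlgHom F K
    rw [← hσdef, h1, orderOf_one, hK] at h2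
    omega
  have hbij := toExtension_bijective (n := n) hK hω
  let S : Submodule F ((Fin n → F) × (Fin n → F)) := (C.restrictScalars F).comap (toExtension n ω)
  have hmem (s) : s ∈ S ↔ toExtension n ω s ∈ C := Iff.rfl
  simp only [← hσq] at hC hd
  have hperp (e) : (∀ s ∈ S, symp s e = 0) ↔
      ∀ c ∈ C, ∑ i, c i * σ (toExtension n ω e i) = 0 := by
    constructor
    · intro h c hc
      have hfix (r : K) : σ (r * ∑ i, c i * σ (toExtension n ω e i)) =
          r * ∑ i, c i * σ (toExtension n ω e i) := by
        obtain ⟨s, hs⟩ := hbij.2 (r • c)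
        have h1 := (symp_eq_zero_iff hσ hω s e).1 (h s (by rw [hmem, hs]; exact C.smul_mem r hc))
        simpa only [hs, Pi.smul_apply, smul_eq_mul, mul_assoc, ← Finset.mul_sum] using h1
      by_contra hne
      refine hω ?_
      -- All `K`-multiples of the Hermitian product are fixed by `σ`; were it nonzero, `ω` would be
      -- one of them.
      have h2 := hfix (ω / ∑ i, c i * σ (toExtension n ω e i))
      rwa [div_mul_cancel₀ _ hne] at h2
    · intro h s hs
      rw [symp_eq_zero_iff hσ hω, h _ hs, map_zero]
  refine exists_isCode_of_isotropic p S (fun s hs t ht => ?_) ?_ hk ?_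
  · exact (hperp t).2 (fun c hc => hC c hc _ ht) s hs
  · have e : S ≃ C := (Equiv.ofBijective _ hbij).subtypeEquiv fun s => Iff.rfl
    rw [Nat.card_congr e, Module.natCard_eq_pow_finrank (K := K), hrank, Nat.card_eq_fintype_card,
      hcardK, pow_mul]
  · convert hd using 1
    ext w
    have hnorm (e : (Fin n → F) × (Fin n → F)) :
        {i | ¬ (e.1 i = 0 ∧ e.2 i = 0)}.ncard = hammingNorm (toExtension n ω e) := by
      rw [hammingNorm, ← Set.ncard_coe_finset]
      congr 1
      ext i
      simp [toExtension_apply, algebraMap_add_mul_eq_zero_iff hω]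
    constructor
    · rintro ⟨e, h1, h2, rfl⟩
      exact ⟨_, (hperp e).1 h1, h2, (hnorm e).symm⟩
    · rintro ⟨v, h1, h2, rfl⟩
      obtain ⟨e, rfl⟩ := hbij.2 v
      exact ⟨e, (hperp e).2 h1, h2, hnorm e⟩

end Hermitian

end QuantumCode

/-! ### Preliminaries on finite fields and linear algebra -/

/-- Over a finite field there are monic polynomials without roots in every degree other than `1`. -/
theorem FiniteField.exists_monic_natDegree_eq_forall_eval_ne_zero (K : Type*) [Field K] [Finite K]
    {m : ℕ} (hm : m ≠ 1) : ∃ u : K[X], u.Monic ∧ u.natDegree = m ∧ ∀ x, u.eval x ≠ 0 := by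
  obtain rfl | hm0 := eq_or_ne m 0
  · exact ⟨1, monic_one, natDegree_one, by simp⟩
  -- The map takes the value `0` at both `0` and `1`, so by finiteness it misses some `c`; then `X ^
  -- m - X - c` has no root.
  have hns : ¬ Function.Surjective fun x : K => x ^ m - x := by
    rw [← Finite.injective_iff_surjective]
    intro h
    exact zero_ne_one (h (by simp [hm0] : (0 : K) ^ m - 0 = 1 ^ m - 1))
  simp only [Function.Surjective, not_forall, not_exists] at hns
  obtain ⟨c, hc⟩ := hns
  have hdeg : (-(X + C c) : K[X]).degree < m := by
    rw [degree_neg, degree_X_add_C]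
    exact_mod_cast (by omega : 1 < m)
  refine ⟨X ^ m + -(X + C c), monic_X_pow_add hdeg, ?_, fun x h => hc x ?_⟩
  · refine natDegree_eq_of_degree_eq_some ?_
    rw [degree_add_eq_left_of_degree_lt (by rwa [degree_X_pow]), degree_X_pow]
  · simp only [eval_add, eval_pow, eval_X, eval_neg, eval_C] at h
    linear_combination h

theorem FiniteField.sum_pow_card_sub_one (K : Type*) [Field K] [Fintype K] :
    ∑ x : K, x ^ (Fintype.card K - 1) = -1 := by
  classical
  have h (x : K) : x ^ (Fintype.card K - 1) = 1 - if x = 0 then 1 else 0 := by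
    split_ifs with hx
    · have := Fintype.one_lt_card (α := K)
      rw [hx, zero_pow (by omega), sub_self]
    · rw [FiniteField.pow_card_sub_one_eq_one x hx, sub_zero]
  simp [h]

/-- If `E` maps into `K ^ ι` and its source has dimension less than `|T|`, then a nonzero vector
supported on `T` is orthogonal to the image of `E`. -/
theorem LinearMap.exists_ne_zero_forall_sum_eq_zero_of_finrank_lt_card
    {K ι V : Type*} [Field K] [Fintype ι] [DecidableEq ι]
    [AddCommGroup V] [Module K V] [FiniteDimensional K V] (E : V →ₗ[K] (ι → K)) (T : Finset ι)
    (hT : Module.finrank K V < T.card) :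
    ∃ w : ι → K, w ≠ 0 ∧ (∀ i ∉ T, w i = 0) ∧ ∀ f, ∑ i, E f i * w i = 0 := by
  -- Restricted to `T`, the image is a proper subspace; the coefficients of a functional vanishing
  -- on it give `w`.
  let A : V →ₗ[K] (T → K) := LinearMap.funLeft K K ((↑) : T → ι) ∘ₗ E
  have hlt : LinearMap.range A < ⊤ := by
    refine lt_top_iff_ne_top.2 fun htop => ?_
    have h1 := LinearMap.finrank_range_le A
    rw [htop, finrank_top, Module.finrank_fintype_fun_eq_card, Fintype.card_coe] at h1
    omega
  obtain ⟨φ, hφ0, hφ⟩ := Submodule.exists_le_ker_of_lt_top _ hlt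
  let w₀ : T → K := fun i => φ fun j => if i = j then 1 else 0
  have hw₀ (g : T → K) : φ g = ∑ i, g i * w₀ i := φ.pi_apply_eq_sum_univ g
  refine ⟨fun i => if h : i ∈ T then w₀ ⟨i, h⟩ else 0, fun h0 => hφ0 ?_, fun i hi => dif_neg hi,
    fun f => ?_⟩
  · refine LinearMap.ext fun g => ?_
    rw [hw₀]
    refine Finset.sum_eq_zero fun i _ => ?_
    have := congrFun h0 i
    simp only [Finset.coe_mem, dif_pos, Subtype.coe_eta, Pi.zero_apply] at this
    rw [this, mul_zero]
  · have h1 : φ (A f) = 0 := hφ ⟨f, rfl⟩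
    rw [hw₀] at h1
    rw [← Finset.sum_subset (Finset.subset_univ T) fun i _ hi => by simp [hi],
      ← Finset.sum_coe_sort]
    refine Eq.trans ?_ h1
    refine Finset.sum_congr rfl fun i _ => ?_
    simp [A, LinearMap.funLeft_apply]

namespace QuantumCode

/-! ### Extended generalised Reed-Solomon codes -/

section ReedSolomon

variable {K : Type*} [Field K]

/-- The values of a polynomial at the points of the projective line `K ∪ {∞}`, where the value at
`∞` is the coefficient of degree `m`. -/
def projEval (m : ℕ) : K[X] →ₗ[K] (Option K → K) where
  toFun g o := o.elim (g.coeff m) fun x => g.eval x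
  map_add' g h := by ext (_ | x) <;> simp
  map_smul' c g := by ext (_ | x) <;> simp

@[simp] theorem projEval_none (m : ℕ) (g : K[X]) : projEval m g none = g.coeff m := rfl

@[simp] theorem projEval_some (m : ℕ) (g : K[X]) (x : K) :
    projEval m g (some x) = g.eval x := rfl

/-- Polynomials of degree less than `q` are Hermitian self-orthogonal on the projective line
over the field with `q²` elements. -/
theorem sum_projEval_mul_projEval_pow [Fintype K] {F : Type*} [Field F] [Fintype F] [Algebra F K]
    (hcard : Fintype.card K = Fintype.card F ^ 2) {g h : K[X]} (hg : g ∈ degreeLT K (Fintype.card F))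
    (hh : h ∈ degreeLT K (Fintype.card F)) :
    ∑ o, projEval (Fintype.card F - 1) g o *
      projEval (Fintype.card F - 1) h o ^ Fintype.card F = 0 := by
  set q := Fintype.card F with hq
  have hq1 : 1 < q := Fintype.one_lt_card
  have hnat {f : K[X]} (hf : f ∈ degreeLT K q) : f.natDegree < q := by
    obtain rfl | hf0 := eq_or_ne f 0
    · rw [natDegree_zero]; omega
    · rwa [natDegree_lt_iff_degree_lt hf0, ← mem_degreeLT]
  have hpow (x : K) : h.eval x ^ q = ∑ j ∈ Finset.range q, h.coeff j ^ q * x ^ (j * q) := by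
    rw [eval_eq_sum_range' (hnat hh)]
    change FiniteField.frobeniusAlgHom F K _ = _
    rw [map_sum]
    refine Finset.sum_congr rfl fun j _ => ?_
    rw [FiniteField.frobeniusAlgHom_apply, mul_pow, ← pow_mul]
  -- Here `i + j * q ≤ q ^ 2 - 1`, with equality only for `i = j = q - 1`; smaller power sums over
  -- `K` vanish.
  have hsum {i j : ℕ} (hi : i < q) (hj : j < q) :
      ∑ x : K, x ^ (i + j * q) = if i = q - 1 ∧ j = q - 1 then -1 else 0 := by
    obtain ⟨r, hr⟩ : ∃ r, q = r + 1 := ⟨q - 1, by omega⟩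
    split_ifs with hij
    · rw [← FiniteField.sum_pow_card_sub_one K, hcard, hij.1, hij.2]
      congr! 2
      rw [hr, Nat.add_sub_cancel, eq_comm, Nat.sub_eq_iff_eq_add (Nat.one_le_pow _ _ (by omega))]
      ring
    · refine FiniteField.sum_pow_lt_card_sub_one K _ ?_
      rw [hcard, hr, Nat.lt_sub_iff_add_lt]
      rw [hr, Nat.add_sub_cancel] at hij
      rcases lt_or_eq_of_le (by omega : j ≤ r) with hjr | rfl
      · nlinarith
      · have : i < j := by omega
        nlinarith
  rw [Fintype.sum_option]
  simp only [projEval_none, projEval_some]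
  have hmain : ∑ x : K, g.eval x * h.eval x ^ q = - (g.coeff (q - 1) * h.coeff (q - 1) ^ q) := by
    calc ∑ x : K, g.eval x * h.eval x ^ q
        = ∑ x : K, ∑ i ∈ Finset.range q, ∑ j ∈ Finset.range q,
            g.coeff i * h.coeff j ^ q * x ^ (i + j * q) := by
          refine Finset.sum_congr rfl fun x _ => ?_
          rw [hpow, eval_eq_sum_range' (hnat hg), Finset.sum_mul_sum]
          refine Finset.sum_congr rfl fun i _ => Finset.sum_congr rfl fun j _ => ?_
          ring
      _ = ∑ i ∈ Finset.range q, ∑ j ∈ Finset.range q,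
            g.coeff i * h.coeff j ^ q * ∑ x : K, x ^ (i + j * q) := by
          rw [Finset.sum_comm]
          refine Finset.sum_congr rfl fun i _ => ?_
          rw [Finset.sum_comm]
          simp only [Finset.mul_sum]
      _ = ∑ i ∈ Finset.range q, ∑ j ∈ Finset.range q,
            g.coeff i * h.coeff j ^ q * if i = q - 1 ∧ j = q - 1 then -1 else 0 := by
          refine Finset.sum_congr rfl fun i hi => Finset.sum_congr rfl fun j hj => ?_
          rw [hsum (Finset.mem_range.1 hi) (Finset.mem_range.1 hj)]
      _ = - (g.coeff (q - 1) * h.coeff (q - 1) ^ q) := by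
          rw [Finset.sum_eq_single (q - 1), Finset.sum_eq_single (q - 1)]
          · simp
          · intro j _ hj
            simp [hj]
          · intro hj
            exact absurd (Finset.mem_range.2 (by omega)) hj
          · intro i _ hi
            simp [hi]
          · intro hi
            exact absurd (Finset.mem_range.2 (by omega)) hi
  rw [hmain, add_neg_cancel]

variable {q k : ℕ} {u : K[X]}

theorem mul_mem_degreeLT (hkq : k ≤ q) (hu : u.natDegree = q - k) {f : K[X]}
    (hf : f ∈ degreeLT K k) : u * f ∈ degreeLT K q := by
  obtain rfl | hf0 := eq_or_ne f 0
  · simp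
  rw [mem_degreeLT, ← natDegree_lt_iff_degree_lt hf0] at hf
  rw [mem_degreeLT]
  refine degree_le_natDegree.trans_lt ?_
  exact_mod_cast (natDegree_mul_le.trans_lt (by omega) : (u * f).natDegree < q)

/-- As `u` is monic of degree `q - k`, the coordinate at `∞` reads off the top coefficient of `f`.
For `k = 0` the truncated `k - 1` is harmless, since `f = 0`. -/
theorem projEval_mul_none (hkq : k ≤ q) (hum : u.Monic) (hu : u.natDegree = q - k) {f : K[X]}
    (hf : f ∈ degreeLT K k) : projEval (q - 1) (u * f) none = f.coeff (k - 1) := by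
  obtain rfl | hf0 := eq_or_ne f 0
  · simp
  rw [mem_degreeLT, ← natDegree_lt_iff_degree_lt hf0] at hf
  rw [projEval_none, show q - 1 = (q - k) + (k - 1) by omega,
    coeff_mul_add_eq_of_natDegree_le hu.le (by omega), ← hu, hum.coeff_natDegree, one_mul]

/-- Any `k` coordinates of the generalised Reed-Solomon code of dimension `k` are independent. -/
theorem exists_projEval_mul_ne_zero (hkq : k ≤ q) (hum : u.Monic) (hu : u.natDegree = q - k)
    (hu0 : ∀ x, u.eval x ≠ 0) (T : Finset (Option K)) {o : Option K} (ho : o ∉ T)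
    (hT : T.card < k) :
    ∃ f ∈ degreeLT K k, (∀ t ∈ T, projEval (q - 1) (u * f) t = 0) ∧
      projEval (q - 1) (u * f) o ≠ 0 := by
  classical
  set f₀ : K[X] := ∏ x ∈ T.eraseNone, (X - C x) with hf₀
  have hmon : f₀.Monic := monic_prod_X_sub_C _ _
  have hnat : f₀.natDegree = T.eraseNone.card :=
    natDegree_finsetProd_X_sub_C_eq_card _ _
  have heval (x : K) : f₀.eval x = 0 ↔ some x ∈ T := by
    rw [hf₀, eval_prod, Finset.prod_eq_zero_iff]
    simp [sub_eq_zero]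
  cases o with
  | none =>
    have hcard : T.eraseNone.card = T.card := by
      rw [Finset.card_eraseNone_of_not_mem ho]
    -- Padding to degree exactly `k - 1` makes the coordinate at `∞` equal to `1`.
    have hXmon : (X ^ (k - 1 - T.card) * f₀).Monic := (monic_X_pow _).mul hmon
    have hXnat : (X ^ (k - 1 - T.card) * f₀).natDegree = k - 1 := by
      rw [(monic_X_pow _).natDegree_mul hmon, natDegree_X_pow, hnat, hcard]
      omega
    have hmem : X ^ (k - 1 - T.card) * f₀ ∈ degreeLT K k := by
      rw [mem_degreeLT, ← natDegree_lt_iff_degree_lt hXmon.ne_zero, hXnat]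
      omega
    refine ⟨_, hmem, fun t ht => ?_, ?_⟩
    · cases t with
      | none => exact absurd ht ho
      | some x =>
        rw [projEval_some, eval_mul, eval_mul, (heval x).2 ht, mul_zero, mul_zero]
    · rw [projEval_mul_none hkq hum hu hmem]
      have h1 := hXmon.coeff_natDegree
      rw [hXnat] at h1
      exact h1 ▸ one_ne_zero
  | some y =>
    have hle : T.eraseNone.card ≤ T.card := Finset.card_eraseNone_le T
    have hmem : f₀ ∈ degreeLT K k := by
      rw [mem_degreeLT, ← natDegree_lt_iff_degree_lt hmon.ne_zero, hnat]
      omega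
    refine ⟨f₀, hmem, fun t ht => ?_, ?_⟩
    · cases t with
      | none =>
        -- When `∞ ∈ T`, the degree of `f₀` is `T.card - 1 < k - 1`.
        rw [projEval_mul_none hkq hum hu hmem]
        refine coeff_eq_zero_of_natDegree_lt ?_
        have := Finset.card_eraseNone_of_mem ht
        have := Finset.card_pos.2 ⟨_, ht⟩
        omega
      | some x => rw [projEval_some, eval_mul, (heval x).2 ht, mul_zero]
    · rw [projEval_some, eval_mul]
      exact mul_ne_zero (hu0 y) fun h => ho ((heval y).1 h)

theorem eq_zero_of_projEval_mul_eq_zero (hu0 : ∀ x, u.eval x ≠ 0) {f : K[X]}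
    (hf : f ∈ degreeLT K k) (s : Finset K) (hs : k ≤ s.card)
    (h : ∀ x ∈ s, projEval (q - 1) (u * f) (some x) = 0) : f = 0 := by
  refine eq_zero_of_degree_lt_of_eval_finset_eq_zero s
    ((mem_degreeLT.1 hf).trans_le (by exact_mod_cast hs)) fun x hx => ?_
  have := h x hx
  rw [projEval_some, eval_mul] at this
  exact (mul_eq_zero.1 this).resolve_left (hu0 x)

variable [Fintype K] [DecidableEq K]

/-- The minimum distance of the Hermitian dual of the generalised Reed-Solomon code. -/
theorem lt_hammingNorm_of_forall_sum_eq_zero (hkq : k ≤ q) (hum : u.Monic)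
    (hu : u.natDegree = q - k) (hu0 : ∀ x, u.eval x ≠ 0) {m : ℕ} (hm : m ≠ 0)
    {v : Option K → K} (hv : v ≠ 0)
    (h : ∀ f ∈ degreeLT K k, ∑ o, projEval (q - 1) (u * f) o * v o ^ m = 0) :
    k < hammingNorm v := by
  by_contra! hle
  obtain ⟨o, ho⟩ := Function.ne_iff.1 hv
  have hoT : o ∈ ({i | v i ≠ 0} : Finset (Option K)) := by simpa using ho
  -- A codeword vanishing on the support of `v` except at `o` leaves a single nonzero term in the
  -- orthogonality relation.
  obtain ⟨f, hf, hfT, hfo⟩ := exists_projEval_mul_ne_zero hkq hum hu hu0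
    (({i | v i ≠ 0} : Finset (Option K)).erase o) (Finset.notMem_erase o _)
    ((Finset.card_erase_lt_of_mem hoT).trans_le hle)
  have hs := h f hf
  rw [Finset.sum_eq_single o] at hs
  · exact mul_ne_zero hfo (pow_ne_zero m ho) hs
  · intro t _ hto
    by_cases hvt : v t = 0
    · rw [hvt, zero_pow hm, mul_zero]
    · rw [hfT t (by simp [hto, hvt]), zero_mul]
  · simp

/-- The Hermitian dual of the generalised Reed-Solomon code of dimension `k` contains a vector of
weight `k + 1` that does not belong to the code. -/
theorem exists_hammingNorm_eq_add_one (hkq : k ≤ q) (hq : 2 ≤ q) (hum : u.Monic)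
    (hu : u.natDegree = q - k) (hu0 : ∀ x, u.eval x ≠ 0) (hcard : Fintype.card K = q ^ 2) :
    ∃ v : Option K → K, (∀ f ∈ degreeLT K k, ∑ o, projEval (q - 1) (u * f) o * v o ^ q = 0) ∧
      (∀ f ∈ degreeLT K k, projEval (q - 1) (u * f) ≠ v) ∧ hammingNorm v = k + 1 := by
  have h2k : 2 * k ≤ q ^ 2 := by nlinarith
  -- With `∞ ∈ T`, a codeword supported on `T` vanishes at `q ^ 2 - k ≥ k` points of `K`, so it is
  -- zero.
  obtain ⟨T, hnone, hT⟩ : ∃ T : Finset (Option K), none ∈ T ∧ T.card = k + 1 := by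
    obtain ⟨T, hT, hTc⟩ := Finset.exists_superset_card_eq (s := {(none : Option K)}) (n := k + 1)
      (by simp) (by rw [Fintype.card_option, hcard]; omega)
    exact ⟨T, by simpa using hT, hTc⟩
  obtain ⟨w, hw0, hwT, hw⟩ := LinearMap.exists_ne_zero_forall_sum_eq_zero_of_finrank_lt_card
    (projEval (q - 1) ∘ₗ LinearMap.mulLeft K u ∘ₗ (degreeLT K k).subtype) T (by
      rw [(degreeLTEquiv K k).finrank_eq, Module.finrank_fin_fun, hT]
      omega)
  -- Since `v ^ q = w ^ (q ^ 2) = w`, ordinary orthogonality for `w` is Hermitian orthogonality for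
  -- `v`, with the same support.
  set v : Option K → K := fun o => w o ^ q with hv
  have hvne (o) : v o ≠ 0 ↔ w o ≠ 0 := pow_ne_zero_iff (by omega)
  have hv0 : v ≠ 0 := by
    obtain ⟨o, ho⟩ := Function.ne_iff.1 hw0
    exact Function.ne_iff.2 ⟨o, (hvne o).2 ho⟩
  have hdual : ∀ f ∈ degreeLT K k, ∑ o, projEval (q - 1) (u * f) o * v o ^ q = 0 := by
    intro f hf
    rw [← hw ⟨f, hf⟩]
    refine Finset.sum_congr rfl fun o _ => ?_
    rw [hv, ← pow_mul, ← sq, ← hcard, FiniteField.pow_card]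
    rfl
  have hvT (o) (ho : o ∉ T) : v o = 0 := by
    by_contra h
    exact (hvne o).1 h (hwT o ho)
  refine ⟨v, hdual, fun f hf hfv => hv0 ?_, le_antisymm ?_
    (lt_hammingNorm_of_forall_sum_eq_zero hkq hum hu hu0 (by omega) hv0 hdual)⟩
  · rw [← hfv, eq_zero_of_projEval_mul_eq_zero (q := q) hu0 hf T.eraseNoneᶜ ?_ ?_, mul_zero,
      map_zero]
    · rw [Finset.card_compl, Finset.card_eraseNone_of_mem hnone, hT, hcard]
      omega
    · intro x hx
      rw [hfv]
      exact hvT _ (by simpa using hx)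
  · rw [← hT]
    refine Finset.card_le_card fun o ho => ?_
    by_contra h
    exact (Finset.mem_filter.1 ho).2 (hvT o h)

end ReedSolomon

end QuantumCode

/-! ### The quantum MDS codes -/

theorem mainTheorem1 (p : ℕ) [Fact p.Prime] (F : Type*) [Field F] [Fintype F] [DecidableEq F]
    [Algebra (ZMod p) F] (q : ℕ) (hq : Fintype.card F = q)
    (k : ℕ) (hk : k ≤ q) (hk' : k ≠ q - 1) :
    ∃ Q : Submodule ℂ (QuantumCode.StateSpace F (q ^ 2 + 1)),
      QuantumCode.IsMDSCode p Q (q ^ 2 + 1 - 2 * k) (k + 1) := by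
  classical
  have hq2 : 2 ≤ q := hq ▸ Fintype.one_lt_card
  have h2k : 2 * k ≤ q ^ 2 + 1 := by nlinarith
  have : CharP F p := charP_of_injective_algebraMap (algebraMap (ZMod p) F).injective p
  let K := FiniteField.Extension F p 2
  have hK : Module.finrank F K = 2 := FiniteField.finrank_extension F p 2
  have : Fintype K := Fintype.ofFinite K
  have hcard : Fintype.card K = q ^ 2 := by
    rw [← hq, ← hK]; exact Module.card_eq_pow_finrank
  -- The exclusion `k ≠ q - 1` enters here: a linear `u` would have a root.
  obtain ⟨u, hum, hu, hu0⟩ :=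
    FiniteField.exists_monic_natDegree_eq_forall_eval_ne_zero K (m := q - k) (by omega)
  let e : Fin (q ^ 2 + 1) ≃ Option K := Fintype.equivOfCardEq (by simp [hcard])
  let E : degreeLT K k →ₗ[K] (Fin (q ^ 2 + 1) → K) := LinearMap.funLeft K K e ∘ₗ
    QuantumCode.projEval (q - 1) ∘ₗ LinearMap.mulLeft K u ∘ₗ (degreeLT K k).subtype
  have hE (f : degreeLT K k) (i) : E f i = QuantumCode.projEval (q - 1) (u * f.1) (e i) := rfl
  have hinj : Function.Injective E := by
    rw [← LinearMap.ker_eq_bot, LinearMap.ker_eq_bot']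
    intro f hf
    refine Subtype.ext (QuantumCode.eq_zero_of_projEval_mul_eq_zero (q := q) hu0 f.2 Finset.univ
      (by rw [Finset.card_univ, hcard]; nlinarith) fun x _ => ?_)
    simpa [hE] using congrFun hf (e.symm (some x))
  have hnorm (v : Option K → K) : hammingNorm (v ∘ e) = hammingNorm v :=
    Finset.card_bijective e e.bijective (by simp)
  suffices h : ∃ Q : Submodule ℂ (QuantumCode.StateSpace F (q ^ 2 + 1)),
      QuantumCode.IsCode p Q (q ^ 2 + 1 - 2 * k) (k + 1) by
    obtain ⟨Q, hQ⟩ := h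
    refine ⟨Q, hQ, ?_⟩
    push_cast [Nat.cast_sub h2k]
    ring
  refine QuantumCode.exists_isCode_of_hermitian p hK (LinearMap.range E) ?_ ?_ h2k ⟨?_, ?_⟩
  · rintro _ ⟨f, rfl⟩ _ ⟨g, rfl⟩
    rw [← QuantumCode.sum_projEval_mul_projEval_pow (hq ▸ hcard)
      (hq ▸ QuantumCode.mul_mem_degreeLT hk hu f.2) (hq ▸ QuantumCode.mul_mem_degreeLT hk hu g.2),
      hq, ← e.sum_comp]
    rfl
  · rw [LinearMap.finrank_range_of_inj hinj, (degreeLTEquiv K k).finrank_eq,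
      Module.finrank_fin_fun]
  · obtain ⟨v, h1, h2, h3⟩ :=
      QuantumCode.exists_hammingNorm_eq_add_one hk hq2 hum hu hu0 hcard
    refine ⟨v ∘ e, ?_, ?_, by rw [hnorm, h3]⟩
    · rintro _ ⟨f, rfl⟩
      rw [← h1 f f.2, hq, ← e.sum_comp]
      rfl
    · rintro ⟨f, hf⟩
      refine h2 f f.2 (funext fun o => ?_)
      simpa [hE] using congrFun hf (e.symm o)
  · rintro w ⟨v, h1, h2, rfl⟩
    have hv : v = (v ∘ e.symm) ∘ e := by
      ext i
      simp
    rw [hv, hnorm]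
    refine QuantumCode.lt_hammingNorm_of_forall_sum_eq_zero hk hum hu hu0 (m := q) (by omega) ?_ ?_
    · intro h0
      refine h2 ?_
      rw [hv, h0]
      exact Submodule.zero_mem _
    · intro f hf
      rw [← h1 _ ⟨⟨f, hf⟩, rfl⟩, hq, ← e.sum_comp]
      simp [hE]
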